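/- Let $d\ge 3$, $m\ge 1$, $n\ge 1$ be integers and let $C_d$ be the cycle graph on the vertex set $\{1,\dots,d\}$. For each vertex $i$ put $V_i=\mathbb{C}^n$ and $W_i=\bigotimes_{e\ni i}\mathbb{C}^m$, the tensor product over the two edges $e$ incident to $i$, and let $v_1,\dots,v_m$ be the standard basis of $\mathbb{C}^m$. The graph tensor of $C_d$ with constant bond dimension $m$ is \[ T(C_d,m)=\sum_{j}\ \bigotimes_{i=1}^{d}\Bigl(\bigotimes_{e\ni i}v_{j_e}\Bigr)\in W_1\otimes\cdots\otimes W_d , \] the sum running over all families $j=(j_e)_e$ of indices $j_e\in\{1,\dots,m\}$, one for every edge $e$ of $C_d$. The tensor network variety (variety of matrix product states with periodic boundary conditions) with constant bond dimension $m$ and constant local dimension $n$ is the Zariski closure \[ \mathcal{TNS}^{C_d}_{m,n}=\overline{\bigl\{(X_1\otimes\cdots\otimes X_d)\cdot T(C_d,m)\ :\ X_i\in\operatorname{Hom}(W_i,V_i)\bigr\}}\subseteq V_1\otimes\cdots\otimes V_d . \] Then its dimension as an affine algebraic variety satisfies \[ \dim \mathcal{TNS}^{C_d}_{m,n}\ \le\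 \min\{\,d(n-1)m^2+1,\ n^d\,\}. \] -/

import Mathlib

open scoped TensorProduct

noncomputable section

namespace TensorNetwork

/-! ### Affine algebraic geometry in `ℂ^σ` -/

/-- The Zariski closure of a subset of the affine space `ℂ^σ`: the common zeros of all polynomials
that vanish on it. -/
def zariskiClosure {σ : Type} (S : Set (σ → ℂ)) : Set (σ → ℂ) :=
  MvPolynomial.zeroLocus ℂ (MvPolynomial.vanishingIdeal ℂ S)

/-- The coordinate ring `ℂ[x] / I(Z)` of an algebraic set `Z` in the affine space `ℂ^σ`. -/
abbrev CoordinateRing {σ : Type} (Z : Set (σ → ℂ)) : Type :=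
  MvPolynomial σ ℂ ⧸ MvPolynomial.vanishingIdeal ℂ Z

/-- The dimension of an algebraic set in `ℂ^σ`: the Krull dimension of its coordinate ring. -/
def affineDim {σ : Type} (Z : Set (σ → ℂ)) : WithBot ℕ∞ :=
  ringKrullDim (CoordinateRing Z)

/-! ### Tensor networks -/

section Network

variable {ι : Type} (Γ : SimpleGraph ι)

/-- The edges of the graph that are incident to the vertex `i`. -/
abbrev Incident (i : ι) : Type := {e : Γ.edgeSet // i ∈ (e : Sym2 ι)}

/-- The space `W_i = ⨂_{e ∋ i} ℂ^{m_e}` attached to the vertex `i` by the bond dimensions `m`. -/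
abbrev BondSpace (m : Γ.edgeSet → ℕ) (i : ι) : Type :=
  ⨂[ℂ] e : Incident Γ i, (Fin (m e.1) → ℂ)

/-- The space `V_1 ⊗ ⋯ ⊗ V_d` with `V_i = ℂ^{n_i}`. -/
abbrev LocalTensor (n : ι → ℕ) : Type := ⨂[ℂ] i : ι, (Fin (n i) → ℂ)

/-- The graph tensor in `W_1 ⊗ ⋯ ⊗ W_d`. It is the Kronecker product over the edges `e = {i₁, i₂}`
of the identity tensors `∑_j v_j ⊗ v_j` (the factors `v_j`, running over the standard basis of
`ℂ^{m_e}`, being placed at `i₁` and `i₂`). Expanded by multilinearity, it is the sum over all choices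
`j = (j_e)_e` of one basis index for every edge of the tensor whose factor at the vertex `i` is
`⨂_{e ∋ i} v_{j_e}`. -/
def graphTensor [Fintype Γ.edgeSet] [DecidableEq Γ.edgeSet] (m : Γ.edgeSet → ℕ) :
    ⨂[ℂ] i : ι, BondSpace Γ m i :=
  ∑ j : (∀ e : Γ.edgeSet, Fin (m e)),
    ⨂ₜ[ℂ] i : ι, ⨂ₜ[ℂ] e : Incident Γ i, (Pi.single (j e.1) (1 : ℂ) : Fin (m e.1) → ℂ)

/-- The tensors that have a tensor network representation: those of the form
`(X_1 ⊗ ⋯ ⊗ X_d) · T(Γ, m)` with linear maps `X_i : W_i → V_i`. -/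
def representableTensors [Fintype Γ.edgeSet] [DecidableEq Γ.edgeSet]
    (m : Γ.edgeSet → ℕ) (n : ι → ℕ) : Set (LocalTensor n) :=
  {T | ∃ X : ∀ i, BondSpace Γ m i →ₗ[ℂ] (Fin (n i) → ℂ),
    T = PiTensorProduct.map X (graphTensor Γ m)}

/-- The coordinates of a tensor with respect to the standard basis
`e_{k_1} ⊗ ⋯ ⊗ e_{k_d}` of `ℂ^{n_1} ⊗ ⋯ ⊗ ℂ^{n_d}`. -/
def tensorCoords [Finite ι] {n : ι → ℕ} (T : LocalTensor n) : (∀ i, Fin (n i)) → ℂ :=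
  fun k => (Basis.piTensorProduct fun i => Pi.basisFun ℂ (Fin (n i))).repr T k

/-- The tensor network variety: the Zariski closure of the set of tensors that have a tensor network
representation, in the standard coordinates on `V_1 ⊗ ⋯ ⊗ V_d`. -/
def tensorNetworkVariety [Finite ι] [Fintype Γ.edgeSet] [DecidableEq Γ.edgeSet]
    (m : Γ.edgeSet → ℕ) (n : ι → ℕ) : Set ((∀ i, Fin (n i)) → ℂ) :=
  zariskiClosure (tensorCoords '' representableTensors Γ m n)

end Network

end TensorNetwork

end

/-! The coordinates of a represented tensor are traces of cyclic products of matrices `A i (k i)`,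
and these are unchanged by the gauge action `A i k ↦ g i * A i k * (g (i + 1))⁻¹`
(`cyclicContraction_gauge`). Generically the gauge turns `A i 0` into the identity at every vertex
but the last. Simultaneous conjugation remains; it makes `e₀` an eigenvector of `A 0 1` and then the
last `A i 0` a companion matrix. The other matrices have d(n-1)m² entries; the companion matrix adds
m parameters and the eigenvector condition removes m-1, whence the +1. Families outside the generic
locus are reached by joining them to a good family by a line: a polynomial in t that vanishes for
almost all t vanishes at t = 0 (`evalContraction_eq_zero_of_line`). So the relations among the
normal-form coordinates hold on the whole variety, and `affineDim_zariskiClosure_le` bounds its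
dimension by the number of parameters. -/

/-- Krull dimension does not increase along an integral extension. -/
theorem ringKrullDim_le_of_algHom_isIntegral {R S : Type*} [CommRing R] [CommRing S]
    (f : R →+* S) (hf : f.IsIntegral) : ringKrullDim S ≤ ringKrullDim R := by
  algebraize [f]
  have : Algebra.IsIntegral R S := ⟨hf⟩
  refine Order.krullDim_le_of_strictMono (PrimeSpectrum.comap f) fun I J hIJ => ?_
  exact Ideal.IsIntegral.comap_lt_comap (R := R) (I := I.asIdeal) (J := J.asIdeal) hIJ

/-- An algebra of finite type that embeds into a polynomial ring in the variables `τ` has Krull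
dimension at most the number of variables. -/
theorem ringKrullDim_le_card_of_injective {k R τ : Type} [Field k] [CommRing R] [Algebra k R]
    [Algebra.FiniteType k R] [Finite τ] (f : R →ₐ[k] MvPolynomial τ k)
    (hf : Function.Injective f) : ringKrullDim R ≤ (Nat.card τ : WithBot ℕ∞) := by
  have : Nontrivial R := f.toRingHom.domain_nontrivial
  -- Noether normalization: `R` is integral over a polynomial ring in `s` variables, and
  -- transcendence degree gives `s ≤ card τ`.
  obtain ⟨s, g, hg, hint⟩ := exists_integral_inj_algHom_of_fg k R
  refine (ringKrullDim_le_of_algHom_isIntegral g.toRingHom hint).trans ?_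
  rw [MvPolynomial.ringKrullDim_of_isNoetherianRing, ringKrullDim_eq_zero_of_field, zero_add]
  have h := trdeg_le_of_injective (f.comp g) (hf.comp hg)
  rw [MvPolynomial.trdeg_of_isDomain, MvPolynomial.trdeg_of_isDomain] at h
  have : Fintype τ := Fintype.ofFinite τ
  simp only [Cardinal.lift_id, Cardinal.mk_fintype, Nat.cast_le,
    Fintype.card_fin] at h
  rw [Nat.card_fin, Nat.card_eq_fintype_card]
  exact_mod_cast h

namespace TensorNetwork

theorem vanishingIdeal_zariskiClosure {σ : Type} (S : Set (σ → ℂ)) :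
    MvPolynomial.vanishingIdeal ℂ (zariskiClosure S) = MvPolynomial.vanishingIdeal ℂ S :=
  le_antisymm
    (MvPolynomial.vanishingIdeal_anti_mono (MvPolynomial.zeroLocus_vanishingIdeal_le S))
    (MvPolynomial.le_vanishingIdeal_zeroLocus _)

/-- If the polynomial relations between the polynomials `f` in the variables `τ` hold on `S`, then
the closure of `S` has dimension at most the number of variables. -/
theorem affineDim_zariskiClosure_le {σ τ : Type} [Finite σ] [Finite τ]
    (f : σ → MvPolynomial τ ℂ) (S : Set (σ → ℂ))
    (h : ∀ P : MvPolynomial σ ℂ, MvPolynomial.aeval f P = 0 →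
      ∀ x ∈ S, MvPolynomial.aeval x P = 0) :
    affineDim (zariskiClosure S) ≤ (Nat.card τ : WithBot ℕ∞) := by
  have hle : RingHom.ker (MvPolynomial.aeval (R := ℂ) f) ≤
      MvPolynomial.vanishingIdeal ℂ (zariskiClosure S) := by
    rw [vanishingIdeal_zariskiClosure]
    exact fun P hP x hx => h P hP x hx
  -- The coordinate ring is a quotient of the algebra generated by the `f k`, which embeds in the
  -- polynomial ring in `τ`.
  refine (ringKrullDim_le_of_surjective _ (Ideal.Quotient.factor_surjective hle)).trans ?_
  exact ringKrullDim_le_card_of_injective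
    (Ideal.kerLiftAlg (MvPolynomial.aeval (R := ℂ) f)) (Ideal.kerLiftAlg_injective _)

/-! ### Cyclic contractions of matrices -/

section Contraction

variable {d m : ℕ} {R S : Type*} [CommRing R] [CommRing S]

/-- The trace of the product of a cyclic family of matrices, expanded in the entries. -/
def cyclicContraction (M : Fin (d + 1) → Matrix (Fin m) (Fin m) R) : R :=
  ∑ j : Fin (d + 1) → Fin m, ∏ i, M i (j i) (j (i + 1))

theorem map_cyclicContraction (φ : R →+* S) (M : Fin (d + 1) → Matrix (Fin m) (Fin m) R) :
    φ (cyclicContraction M) = cyclicContraction fun i => (M i).map φ := by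
  simp [cyclicContraction, map_sum, map_prod]

/-- Around the cycle each `h i` meets `g i` and cancels. In entries: summing over `j` first yields
Kronecker deltas that glue the indices `c` of neighbouring matrices. -/
theorem cyclicContraction_gauge (M g h : Fin (d + 1) → Matrix (Fin m) (Fin m) R)
    (hg : ∀ i, h i * g i = 1) :
    cyclicContraction (fun i => g i * M i * h (i + 1)) = cyclicContraction M := by
  have expand : ∀ j : Fin (d + 1) → Fin m, ∏ i, (g i * M i * h (i + 1)) (j i) (j (i + 1)) =
      ∑ c : Fin (d + 1) → Fin m × Fin m,
        (∏ i, M i (c i).1 (c i).2) * ∏ i, (h i (c (i - 1)).2 (j i) * g i (j i) (c i).1) := by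
    intro j
    have h1 : ∀ i, (g i * M i * h (i + 1)) (j i) (j (i + 1)) =
        ∑ c : Fin m × Fin m, g i (j i) c.1 * M i c.1 c.2 * h (i + 1) c.2 (j (i + 1)) := by
      intro i
      rw [Fintype.sum_prod_type_right]
      simp [Matrix.mul_apply, Finset.sum_mul]
    simp_rw [h1, Finset.prod_univ_sum, Fintype.piFinset_univ]
    refine Finset.sum_congr rfl fun c _ => ?_
    -- Shifting the cyclic index pairs `h` with the `g` of the same vertex.
    have h2 : ∏ i, h i (c (i - 1)).2 (j i) = ∏ i, h (i + 1) (c i).2 (j (i + 1)) := by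
      rw [← Equiv.prod_comp (Equiv.addRight (1 : Fin (d + 1)))]
      simp
    simp only [Finset.prod_mul_distrib]
    rw [h2]
    ring
  have collapse : ∀ c : Fin (d + 1) → Fin m × Fin m,
      ∑ j : Fin (d + 1) → Fin m, ∏ i, (h i (c (i - 1)).2 (j i) * g i (j i) (c i).1) =
        if ∀ i, (c (i - 1)).2 = (c i).1 then 1 else 0 := by
    intro c
    rw [← Fintype.piFinset_univ, ← Finset.prod_univ_sum (fun _ => Finset.univ)
      (fun i a => h i (c (i - 1)).2 a * g i a (c i).1)]
    simp_rw [← Matrix.mul_apply, hg, Matrix.one_apply]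
    rw [Finset.prod_ite_zero]
    simp
  unfold cyclicContraction
  simp_rw [expand]
  rw [Finset.sum_comm]
  simp_rw [← Finset.mul_sum, collapse, mul_ite, mul_one, mul_zero]
  rw [← Finset.sum_filter]
  symm
  refine Finset.sum_bij (fun j _ i => (j i, j (i + 1))) ?_ ?_ ?_ ?_
  · intro j _
    simp
  · intro j _ j' _ hj
    funext i
    exact congrArg Prod.fst (congrFun hj i)
  · intro c hc
    refine ⟨fun i => (c i).1, Finset.mem_univ _, ?_⟩
    funext i
    have := (Finset.mem_filter.1 hc).2 (i + 1)
    rw [add_sub_cancel_right] at this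
    exact Prod.ext rfl this.symm
  · intro j _
    rfl

end Contraction

/-! ### Tensors on the cycle as matrix product states -/

theorem tensorCoords_map_graphTensor {ι : Type} [Fintype ι] (Γ : SimpleGraph ι)
    [Fintype Γ.edgeSet] [DecidableEq Γ.edgeSet] (m : Γ.edgeSet → ℕ) (n : ι → ℕ)
    (X : ∀ i, BondSpace Γ m i →ₗ[ℂ] (Fin (n i) → ℂ)) (k : ∀ i, Fin (n i)) :
    tensorCoords (PiTensorProduct.map X (graphTensor Γ m)) k =
      ∑ j : (∀ e : Γ.edgeSet, Fin (m e)), ∏ i, X i (⨂ₜ[ℂ] e : Incident Γ i,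
        (Pi.single (j e.1) (1 : ℂ) : Fin (m e.1) → ℂ)) (k i) := by
  simp only [tensorCoords, graphTensor, map_sum, PiTensorProduct.map_tprod, Finsupp.coe_finsetSum,
    Finset.sum_apply, Basis.piTensorProduct_repr_tprod_apply, Pi.basisFun_repr]

/-- The edges of a cycle of length at least three, the edge `i` joining `i - 1` and `i`. -/
noncomputable def cycleEdgeEquiv (d : ℕ) :
    Fin (d + 3) ≃ (SimpleGraph.cycleGraph (d + 3)).edgeSet :=
  Equiv.ofBijective
    (fun i => ⟨s(i - 1, i), by
      rw [SimpleGraph.mem_edgeSet, SimpleGraph.cycleGraph_adj]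
      exact Or.inr (sub_sub_cancel i 1)⟩) <| by
    constructor
    · intro i j hij
      rcases Sym2.eq_iff.1 (congrArg Subtype.val hij) with ⟨_, h⟩ | ⟨h1, h2⟩
      · exact h
      · exfalso
        -- Length at least three enters here: on two vertices the edges `{i - 1, i}` would coincide.
        have h3 : (1 : Fin (d + 3)) + 1 = 0 := by
          rw [h2] at h1
          have := sub_eq_zero.2 h1
          calc (1 : Fin (d + 3)) + 1 = -(j - 1 - 1 - j) := by abel
            _ = 0 := by rw [this, neg_zero]
        have := congrArg Fin.val h3
        rw [Fin.val_add, Fin.val_one, Nat.mod_eq_of_lt (by omega)] at this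
        simp at this
    · rintro ⟨e, he⟩
      induction e using Sym2.ind with
      | _ u v =>
        rw [SimpleGraph.mem_edgeSet, SimpleGraph.cycleGraph_adj] at he
        rcases he with h | h
        · refine ⟨u, Subtype.ext ?_⟩
          change s(u - 1, u) = s(u, v)
          rw [Sym2.eq_swap, ← h, sub_sub_cancel]
        · refine ⟨v, Subtype.ext ?_⟩
          change s(v - 1, v) = s(u, v)
          rw [← h, sub_sub_cancel]

theorem mem_cycleEdgeEquiv {d : ℕ} {i j : Fin (d + 3)}
    (h : i ∈ (cycleEdgeEquiv d j : Sym2 (Fin (d + 3)))) : j = i ∨ j = i + 1 := by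
  have h' : i ∈ s(j - 1, j) := h
  rcases Sym2.mem_iff.1 h' with h | h
  · exact Or.inr (eq_add_of_sub_eq h.symm)
  · exact Or.inl h.symm

/-- Tensors represented by a cycle have cyclic contractions as their coordinates. -/
theorem exists_tensorCoords_eq_cyclicContraction {d m n : ℕ}
    [Fintype (SimpleGraph.cycleGraph (d + 3)).edgeSet]
    [DecidableEq (SimpleGraph.cycleGraph (d + 3)).edgeSet]
    {T : LocalTensor fun _ : Fin (d + 3) => n}
    (hT : T ∈ representableTensors (SimpleGraph.cycleGraph (d + 3)) (fun _ => m) (fun _ => n)) :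
    ∃ A : Fin (d + 3) → Fin n → Matrix (Fin m) (Fin m) ℂ,
      tensorCoords T = fun k => cyclicContraction fun i => A i (k i) := by
  obtain ⟨X, rfl⟩ := hT
  -- At vertex `i`, rows belong to edge `i` and columns to edge `i + 1`.
  refine ⟨fun i k => Matrix.of fun a b => X i (⨂ₜ[ℂ] e :
    Incident (SimpleGraph.cycleGraph (d + 3)) i, (Pi.single
      (if e.1 = cycleEdgeEquiv d i then a else b) (1 : ℂ) : Fin m → ℂ)) k, ?_⟩
  funext k
  rw [tensorCoords_map_graphTensor, cyclicContraction,
    ← Equiv.sum_comp (Equiv.arrowCongr (cycleEdgeEquiv d) (Equiv.refl (Fin m)))]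
  refine Finset.sum_congr rfl fun j _ => Finset.prod_congr rfl fun i _ => ?_
  refine congrFun (congrArg (X i) (congrArg _ (funext fun e => congrArg (fun a =>
    (Pi.single a (1 : ℂ) : Fin m → ℂ)) ?_))) (k i)
  obtain ⟨e, hi⟩ := e
  obtain ⟨l, rfl⟩ := (cycleEdgeEquiv d).surjective e
  rcases mem_cycleEdgeEquiv hi with h | h
  · simp [h]
  · subst h
    by_cases h' : i + 1 = i <;> simp [h']

open Matrix

/-! ### Extending polynomial identities along lines -/

section Density

variable {d n m : ℕ}

/-- The matrices of a line of matrix families, with entries in `ℂ[t]`. -/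
noncomputable def lineFamily (A B : Fin (d + 1) → Fin n → Matrix (Fin m) (Fin m) ℂ)
    (i : Fin (d + 1)) (k : Fin n) : Matrix (Fin m) (Fin m) (Polynomial ℂ) :=
  Matrix.of fun a b =>
    Polynomial.C (A i k a b) + Polynomial.X * Polynomial.C (B i k a b - A i k a b)

theorem map_lineFamily (A B : Fin (d + 1) → Fin n → Matrix (Fin m) (Fin m) ℂ)
    (t : ℂ) (i : Fin (d + 1)) (k : Fin n) :
    (lineFamily A B i k).map (Polynomial.evalRingHom t) = A i k + t • (B i k - A i k) := by
  ext a b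
  simp [lineFamily]

/-- The value of a polynomial at the tensor given by a matrix family. -/
noncomputable def evalContraction (P : MvPolynomial (Fin (d + 1) → Fin n) ℂ)
    (A : Fin (d + 1) → Fin n → Matrix (Fin m) (Fin m) ℂ) : ℂ :=
  MvPolynomial.aeval (fun k => cyclicContraction fun i => A i (k i)) P

theorem evalContraction_gauge (P : MvPolynomial (Fin (d + 1) → Fin n) ℂ)
    (A : Fin (d + 1) → Fin n → Matrix (Fin m) (Fin m) ℂ)
    (g h : Fin (d + 1) → Matrix (Fin m) (Fin m) ℂ) (hg : ∀ i, h i * g i = 1) :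
    evalContraction P (fun i k => g i * A i k * h (i + 1)) = evalContraction P A := by
  unfold evalContraction
  congr 2
  funext k
  exact cyclicContraction_gauge (fun i => A i (k i)) g h hg

/-- Generic vanishing along a line implies vanishing at its points. -/
theorem evalContraction_eq_zero_of_line (P : MvPolynomial (Fin (d + 1) → Fin n) ℂ)
    (A B : Fin (d + 1) → Fin n → Matrix (Fin m) (Fin m) ℂ) (D : Polynomial ℂ)
    (hD : D.eval 1 ≠ 0)
    (h : ∀ t : ℂ, D.eval t ≠ 0 → evalContraction P (fun i k => A i k + t • (B i k - A i k)) = 0) :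
    evalContraction P A = 0 := by
  set q : Polynomial ℂ :=
    MvPolynomial.aeval (fun k => cyclicContraction fun i => lineFamily A B i (k i)) P with hq
  have hev : ∀ t : ℂ, q.eval t = evalContraction P (fun i k => A i k + t • (B i k - A i k)) := by
    intro t
    have h1 : q.eval t = Polynomial.aeval t q := (Polynomial.coe_aeval_eq_eval t ▸ rfl)
    rw [h1, hq, ← AlgHom.comp_apply, MvPolynomial.comp_aeval, evalContraction]
    congr 2
    funext k
    have h2 := map_cyclicContraction (Polynomial.evalRingHom t) fun i => lineFamily A B i (k i)
    simp only [map_lineFamily] at h2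
    simpa using h2
  have hD0 : D ≠ 0 := by
    rintro rfl
    simp at hD
  have hmul : D * q = 0 := Polynomial.funext fun t => by
    by_cases ht : D.eval t = 0
    · simp [ht]
    · simp [hev, h t ht]
  have hq0 : q = 0 := (mul_eq_zero.1 hmul).resolve_left hD0
  have := hev 0
  simpa [hq0] using this.symm

end Density

/-! ### Normal form under the gauge action -/

section NormalForm

variable {d n m : ℕ}

/-- The matrix families in normal form: the first matrix is the identity at every vertex but the
last, where it is a companion matrix, and the second matrix at the vertex `0` has the first basis
vector as an eigenvector. -/
def normalForm {R : Type*} [CommRing R]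
    (y : Option (Fin (d + 1) × Fin (n + 1) × Fin (m + 1) × Fin (m + 1)) → R) (i : Fin (d + 1)) :
    Fin (n + 2) → Matrix (Fin (m + 1)) (Fin (m + 1)) R :=
  Fin.cons
    (if i = Fin.last d then
      -- The variables at `(0, 0, a, 0)` with `a ≠ 0`, left free by the eigenvector condition, are
      -- reused for the companion column; only its top entry needs the extra variable `none`.
      Matrix.of fun a b => if b = Fin.last m then (if a = 0 then y none else y (some (0, 0, a, 0)))
        else if a.val = b.val + 1 then 1 else 0
      else 1)
    fun k => Matrix.of fun a b => if i = 0 ∧ k = 0 ∧ b = 0 ∧ a ≠ 0 then 0 else y (some (i, k, a, b))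

theorem map_normalForm {R S : Type*} [CommRing R] [CommRing S] (φ : R →+* S)
    (y : Option (Fin (d + 1) × Fin (n + 1) × Fin (m + 1) × Fin (m + 1)) → R)
    (i : Fin (d + 1)) (k : Fin (n + 2)) :
    (normalForm y i k).map φ = normalForm (fun t => φ (y t)) i k := by
  ext a b
  refine Fin.cases ?_ (fun k => ?_) k
  · by_cases hi : i = Fin.last d
    · simp [normalForm, hi, apply_ite φ]
    · simp [normalForm, hi, Matrix.one_apply, apply_ite φ]
  · simp only [normalForm, Fin.cons_succ, Matrix.map_apply, Matrix.of_apply, apply_ite φ, map_zero]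

theorem exists_eq_normalForm (A : Fin (d + 1) → Fin (n + 2) → Matrix (Fin (m + 1)) (Fin (m + 1)) ℂ)
    (h1 : ∀ i, i ≠ Fin.last d → A i 0 = 1)
    (h2 : ∀ a, a ≠ 0 → A 0 1 a 0 = 0)
    (h3 : ∀ a b, b ≠ Fin.last m → A (Fin.last d) 0 a b = if a.val = b.val + 1 then 1 else 0) :
    ∃ y, A = normalForm y := by
  refine ⟨fun t => t.elim (A (Fin.last d) 0 0 (Fin.last m)) fun p =>
    if p.1 = 0 ∧ p.2.1 = 0 ∧ p.2.2.2 = 0 ∧ p.2.2.1 ≠ 0 then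
      A (Fin.last d) 0 p.2.2.1 (Fin.last m) else A p.1 p.2.1.succ p.2.2.1 p.2.2.2, ?_⟩
  funext i k
  refine Fin.cases ?_ (fun k => ?_) k
  · by_cases hi : i = Fin.last d
    · ext a b
      subst hi
      by_cases hb : b = Fin.last m
      · by_cases ha : a = 0 <;> simp [normalForm, hb, ha]
      · simp [normalForm, hb, h3 a b hb]
    · simp [normalForm, hi, h1 i hi]
  · ext a b
    by_cases h : i = 0 ∧ k = 0 ∧ b = 0 ∧ a ≠ 0
    · obtain ⟨rfl, rfl, rfl, ha⟩ := h
      simpa [normalForm, ha] using h2 a ha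
    · simp only [normalForm, Fin.cons_succ, Matrix.of_apply, if_neg h, Option.elim]

/-- The matrix with columns `e₀, M e₀, M² e₀, …`. -/
def krylov {R : Type*} [CommRing R] (M : Matrix (Fin (m + 1)) (Fin (m + 1)) R) :
    Matrix (Fin (m + 1)) (Fin (m + 1)) R :=
  Matrix.of fun a b => (M ^ b.val) a 0

theorem map_krylov {R S : Type*} [CommRing R] [CommRing S] (φ : R →+* S)
    (M : Matrix (Fin (m + 1)) (Fin (m + 1)) R) : (krylov M).map φ = krylov (M.map φ) := by
  ext a b
  have h := map_pow φ.mapMatrix M b.val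
  exact congrFun (congrFun h a) 0

theorem krylov_mulVec_single {R : Type*} [CommRing R]
    (M : Matrix (Fin (m + 1)) (Fin (m + 1)) R) :
    krylov M *ᵥ Pi.single 0 1 = Pi.single 0 1 := by
  ext a
  simp [krylov, Matrix.one_apply, Pi.single_apply]

theorem mul_krylov_apply {R : Type*} [CommRing R]
    (M : Matrix (Fin (m + 1)) (Fin (m + 1)) R) (a b b' : Fin (m + 1)) (hb : b'.val = b.val + 1) :
    (M * krylov M) a b = krylov M a b' := by
  simp [krylov, hb, pow_succ', Matrix.mul_apply]

/-- The nilpotent Jordan block. -/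
def shiftMatrix (m : ℕ) : Matrix (Fin (m + 1)) (Fin (m + 1)) ℂ :=
  Matrix.of fun a b => if a.val = b.val + 1 then 1 else 0

theorem krylov_shiftMatrix : krylov (shiftMatrix m) = 1 := by
  have h : ∀ k : ℕ, k < m + 1 → ∀ a : Fin (m + 1),
      (shiftMatrix m ^ k) a 0 = if a.val = k then 1 else 0 := by
    intro k
    induction k with
    | zero => intro _ a; simp only [pow_zero, Matrix.one_apply, Fin.ext_iff, Fin.val_zero]
    | succ k ih =>
      intro hk a
      rw [pow_succ', Matrix.mul_apply, Finset.sum_eq_single ⟨k, by omega⟩]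
      · rw [ih (by omega), if_pos rfl, mul_one]
        rfl
      · intro c _ hc
        rw [ih (by omega), if_neg (fun h => hc (Fin.ext h)), mul_zero]
      · simp
  ext a b
  simp [krylov, h b.val b.isLt, Matrix.one_apply, Fin.ext_iff]

theorem conj_apply_zero_of_eigenvector {K : Type*} [Field K]
    {M g h : Matrix (Fin (m + 1)) (Fin (m + 1)) K} {c : K} (hg : h * g = 1)
    (hM : M *ᵥ (g *ᵥ Pi.single 0 1) = c • (g *ᵥ Pi.single 0 1)) {a : Fin (m + 1)} (ha : a ≠ 0) :
    (h * M * g) a 0 = 0 := by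
  have h1 : (h * M * g) *ᵥ Pi.single 0 1 = c • Pi.single 0 1 := by
    rw [← Matrix.mulVec_mulVec, ← Matrix.mulVec_mulVec, hM, Matrix.mulVec_smul,
      Matrix.mulVec_mulVec, hg, Matrix.one_mulVec]
  have h2 := congrFun h1 a
  simpa [ha] using h2

variable (P : MvPolynomial (Fin (d + 1) → Fin (n + 2)) ℂ)
  (hP : ∀ y, evalContraction P
    (normalForm y : _ → _ → Matrix (Fin (m + 1)) (Fin (m + 1)) ℂ) = 0)

section

variable (A : Fin (d + 1) → Fin (n + 2) → Matrix (Fin (m + 1)) (Fin (m + 1)) ℂ)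

include hP

/-- In the basis `e₀, M e₀, M² e₀, …` the matrix `M` is a companion matrix. This change of basis
fixes `e₀`, so conjugating by it preserves the eigenvector condition as well as the identities. -/
theorem evalContraction_eq_zero_of_krylov
    (h1 : ∀ i, i ≠ Fin.last d → A i 0 = 1)
    (h2 : ∀ a, a ≠ 0 → A 0 1 a 0 = 0) (h3 : (krylov (A (Fin.last d) 0)).det ≠ 0) :
    evalContraction P A = 0 := by
  set K := krylov (A (Fin.last d) 0) with hK
  have hl : K⁻¹ * K = 1 := Matrix.nonsing_inv_mul _ (isUnit_iff_ne_zero.2 h3)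
  have hr : K * K⁻¹ = 1 := Matrix.mul_nonsing_inv _ (isUnit_iff_ne_zero.2 h3)
  rw [← evalContraction_gauge P A (fun _ => K⁻¹) (fun _ => K) fun _ => hr]
  obtain ⟨y, hy⟩ := exists_eq_normalForm (fun i k => K⁻¹ * A i k * K)
    (fun i hi => by simp only [h1 i hi, mul_one, hl])
    (fun a ha => conj_apply_zero_of_eigenvector (c := A 0 1 0 0) hl (by
      rw [hK, krylov_mulVec_single]
      ext b
      by_cases hb : b = 0
      · simp [hb]
      · simp [hb, h2 b hb]) ha)
    (fun a b hb => by
      have hb' : b.val + 1 < m + 1 := by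
        have := Fin.val_lt_last hb
        omega
      have h4 : (K⁻¹ * (A (Fin.last d) 0 * K)) a b = (K⁻¹ * K) a ⟨b.val + 1, hb'⟩ := by
        rw [Matrix.mul_apply, Matrix.mul_apply]
        exact Finset.sum_congr rfl fun c _ => congrArg _ (mul_krylov_apply _ c b _ rfl)
      rw [Matrix.mul_assoc, h4, hl, Matrix.one_apply]
      simp only [Fin.ext_iff])
  rw [hy]
  exact hP y

theorem evalContraction_eq_zero_of_eigenvector
    (h1 : ∀ i, i ≠ Fin.last d → A i 0 = 1)
    (h2 : ∀ a, a ≠ 0 → A 0 1 a 0 = 0) : evalContraction P A = 0 := by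
  -- An endpoint satisfying `h1` and `h2`, both affine conditions, for which `e₀` is cyclic: the
  -- Krylov matrix of the shift is the identity.
  set B : Fin (d + 1) → Fin (n + 2) → Matrix (Fin (m + 1)) (Fin (m + 1)) ℂ :=
    fun i k => if k = 0 then (if i = Fin.last d then shiftMatrix m else 1) else 0 with hB
  have hD : ∀ t : ℂ, (krylov (lineFamily A B (Fin.last d) 0)).det.eval t =
      (krylov (A (Fin.last d) 0 + t • (B (Fin.last d) 0 - A (Fin.last d) 0))).det := by
    intro t
    rw [← map_lineFamily, ← map_krylov]
    exact RingHom.map_det (Polynomial.evalRingHom t) _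
  refine evalContraction_eq_zero_of_line P A B
    (krylov (lineFamily A B (Fin.last d) 0)).det ?_ fun t ht => ?_
  · rw [hD]
    simp [hB, krylov_shiftMatrix]
  · rw [hD] at ht
    refine evalContraction_eq_zero_of_krylov P hP _ (fun i hi => ?_) (fun a ha => ?_) ht
    · simp [hB, hi, h1 i hi]
    · simp [hB, h2 a ha]

/-- Over ℂ the matrix `A 0 1` has an eigenvector; conjugating all matrices by one `g` that sends
`e₀` to it keeps the identities. -/
theorem evalContraction_eq_zero_of_eq_one
    (h1 : ∀ i, i ≠ Fin.last d → A i 0 = 1) : evalContraction P A = 0 := by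
  obtain ⟨c, hc⟩ := Module.End.exists_eigenvalue (Matrix.toLin' (A 0 1))
  obtain ⟨v, hv⟩ := hc.exists_hasEigenvector
  obtain ⟨e, he⟩ := SeparatingDual.exists_continuousLinearEquiv_apply_eq (R := ℂ)
    (x := (Pi.single 0 1 : Fin (m + 1) → ℂ)) (y := v) (by simp) hv.2
  set g := LinearMap.toMatrix' e.toLinearEquiv.toLinearMap
  set h := LinearMap.toMatrix' e.toLinearEquiv.symm.toLinearMap
  have hl : h * g = 1 := by
    rw [← LinearMap.toMatrix'_comp]
    simp
  have hr : g * h = 1 := mul_eq_one_comm.1 hl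
  have hgv : g *ᵥ Pi.single 0 1 = v := by
    rw [← he]
    exact LinearMap.toMatrix'_mulVec _ _
  rw [← evalContraction_gauge P A (fun _ => h) (fun _ => g) fun _ => hr]
  refine evalContraction_eq_zero_of_eigenvector P hP _ (fun i hi => ?_) fun a ha => ?_
  · rw [h1 i hi, mul_one, hl]
  · refine conj_apply_zero_of_eigenvector (c := c) hl ?_ ha
    rw [hgv]
    simpa using hv.apply_eq_smul

theorem evalContraction_eq_zero_of_det_ne_zero (h1 : ∀ i, (A i 0).det ≠ 0) :
    evalContraction P A = 0 := by
  -- `G k` is the product of the first `k` matrices `A i 0`. As a gauge it telescopes, except at the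
  -- last vertex, where `i + 1` wraps to `0`.
  obtain ⟨G, hG0, hG⟩ : ∃ G : ℕ → Matrix (Fin (m + 1)) (Fin (m + 1)) ℂ, G 0 = 1 ∧
      ∀ k, G (k + 1) = G k * (if hk : k < d + 1 then A ⟨k, hk⟩ 0 else 1) :=
    ⟨fun k => Nat.rec 1 (fun k M => M * (if hk : k < d + 1 then A ⟨k, hk⟩ 0 else 1)) k,
      rfl, fun _ => rfl⟩
  have hdet : ∀ k, IsUnit (G k).det := by
    intro k
    induction k with
    | zero => simp [hG0]
    | succ k ih =>
      rw [hG, Matrix.det_mul]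
      refine ih.mul ?_
      split_ifs with hk
      · exact isUnit_iff_ne_zero.2 (h1 _)
      · simp
  rw [← evalContraction_gauge P A (fun i => G i.val) (fun i => (G i.val)⁻¹)
    fun i => Matrix.nonsing_inv_mul _ (hdet _)]
  refine evalContraction_eq_zero_of_eq_one P hP _ fun i hi => ?_
  have h2 : G i.val * A i 0 = G (i.val + 1) := by
    rw [hG, dif_pos i.isLt]
  rw [h2, Fin.val_add_one_of_lt (Fin.lt_last_iff_ne_last.2 hi)]
  exact Matrix.mul_nonsing_inv _ (hdet _)

/-- A polynomial that vanishes at the tensors of the families in normal form vanishes at the tensors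
of all families. -/
theorem evalContraction_eq_zero_of_normalForm : evalContraction P A = 0 := by
  have hD : ∀ t : ℂ, (∏ i, (lineFamily A 1 i 0).det).eval t =
      ∏ i, (A i 0 + t • ((1 : Matrix (Fin (m + 1)) (Fin (m + 1)) ℂ) - A i 0)).det := by
    intro t
    rw [Polynomial.eval_prod]
    refine Finset.prod_congr rfl fun i _ => ?_
    have h := map_lineFamily A 1 t i 0
    simp only [Pi.one_apply] at h
    rw [← h]
    exact RingHom.map_det (Polynomial.evalRingHom t) _
  refine evalContraction_eq_zero_of_line P A 1 (∏ i, (lineFamily A 1 i 0).det) ?_ fun t ht => ?_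
  · rw [hD]
    simp
  · rw [hD] at ht
    exact evalContraction_eq_zero_of_det_ne_zero P hP _ fun i =>
      Finset.prod_ne_zero_iff.1 ht i (Finset.mem_univ i)

end

end NormalForm

/-! ### Dimension bounds -/

/-- Parameter count for matrix product states with at least two local dimensions. -/
theorem affineDim_cycle_le (d m n : ℕ) [Fintype (SimpleGraph.cycleGraph (d + 3)).edgeSet]
    [DecidableEq (SimpleGraph.cycleGraph (d + 3)).edgeSet] :
    affineDim (tensorNetworkVariety (SimpleGraph.cycleGraph (d + 3))
      (fun _ => m + 1) (fun _ => n + 2)) ≤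
      (((d + 3) * (n + 1) * (m + 1) ^ 2 + 1 : ℕ) : WithBot ℕ∞) := by
  have hcard : Nat.card (Option (Fin (d + 3) × Fin (n + 1) × Fin (m + 1) × Fin (m + 1))) =
      (d + 3) * (n + 1) * (m + 1) ^ 2 + 1 := by
    simp only [Nat.card_eq_fintype_card, Fintype.card_option, Fintype.card_prod, Fintype.card_fin]
    ring
  rw [← hcard]
  refine affineDim_zariskiClosure_le (fun k : Fin (d + 3) → Fin (n + 2) =>
    cyclicContraction fun i => normalForm MvPolynomial.X i (k i)) _ ?_
  rintro P hP _ ⟨T, hT, rfl⟩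
  obtain ⟨A, hA⟩ := exists_tensorCoords_eq_cyclicContraction hT
  rw [hA]
  refine evalContraction_eq_zero_of_normalForm P (fun y => ?_) A
  have h := congrArg (MvPolynomial.aeval y) hP
  rw [map_zero, ← AlgHom.comp_apply, MvPolynomial.comp_aeval] at h
  rw [← h, evalContraction]
  congr 2
  funext k
  have h2 := map_cyclicContraction (MvPolynomial.aeval (R := ℂ) y).toRingHom
    fun i : Fin (d + 3) => normalForm MvPolynomial.X i (k i)
  simp only [map_normalForm] at h2
  simpa using h2.symm

/-- The variety is no larger than its ambient space. -/
theorem affineDim_zariskiClosure_le_card {σ : Type} [Finite σ] (S : Set (σ → ℂ)) :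
    affineDim (zariskiClosure S) ≤ (Nat.card σ : WithBot ℕ∞) :=
  affineDim_zariskiClosure_le MvPolynomial.X S fun P hP x _ => by
    rw [MvPolynomial.aeval_X_left_apply] at hP
    rw [hP, map_zero]

end TensorNetwork

theorem corollary1p2 (d m n : ℕ) (hd : 3 ≤ d) (hm : 1 ≤ m) (hn : 1 ≤ n) :
    TensorNetwork.affineDim
        (TensorNetwork.tensorNetworkVariety (SimpleGraph.cycleGraph d)
          (fun _ => m) (fun _ => n)) ≤
      ((min (d * (n - 1) * m ^ 2 + 1) (n ^ d) : ℕ) : WithBot ℕ∞) := by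
  have hamb := TensorNetwork.affineDim_zariskiClosure_le_card (TensorNetwork.tensorCoords ''
    TensorNetwork.representableTensors (SimpleGraph.cycleGraph d) (fun _ => m) (fun _ => n))
  have hcard : Nat.card (Fin d → Fin n) = n ^ d := by simp
  rw [hcard] at hamb
  rcases min_choice (d * (n - 1) * m ^ 2 + 1) (n ^ d) with h | h <;> rw [h]
  · obtain ⟨d, rfl⟩ := Nat.exists_eq_add_of_le' hd
    obtain ⟨m, rfl⟩ := Nat.exists_eq_add_of_le' hm
    -- For `n = 1` there is no second matrix to normalize, but both bounds equal 1.
    rcases hn.eq_or_lt with rfl | hn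
    · simpa [TensorNetwork.tensorNetworkVariety] using hamb
    · obtain ⟨n, rfl⟩ := Nat.exists_eq_add_of_le' hn
      exact TensorNetwork.affineDim_cycle_le d m n
  · exact hamb
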